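/- Fix $C_1,C_2,b>0$. For every $n\ge 1$ let $R_{n,1},\dots,R_{n,n}$ and $\theta_{n,1},\dots,\theta_{n,n}$ be jointly independent random variables, where every $\theta_{n,j}$ is uniformly distributed on $[0,2\pi)$ and every $R_{n,j}$ has the folded Cauchy distribution with scale $a_n=\frac{\pi b}{2n}$, that is, the density $\frac{2}{\pi}\frac{a_n}{r^2+a_n^2}$ on $r>0$. Put $\Delta_i^{(n)}=C_i n^{-1/2}$ for $i=1,2$, and $$\hat X_n=\sum_{j=1}^n\bigl(R_{n,j}+\Delta_1^{(n)}\bigr)\cos\theta_{n,j},\qquad \hat Y_n=\sum_{j=1}^n\bigl(R_{n,j}+\Delta_2^{(n)}\bigr)\sin\theta_{n,j}.$$ Then, as $n\to\infty$, the law of $(\hat X_n,\hat Y_n)$ converges weakly to the convolution of two probability laws on $\mathbb{R}^2$: the centred Gaussian law with independent components of variances $\frac{C_1^2}{2}$ and $\frac{C_2^2}{2}$, and the circular bivariate Cauchy law with shape parameter $b$, whose density is $$\frac{1}{2\pi}\,\frac{b}{(b^2+x_1^2+x_2^2)^{3/2}}$$ and whose characteristic function at $(\alpha,\beta)\in\mathbb{R}^2$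 is $e^{-b\sqrt{\alpha^2+\beta^2}}$. -/

import Mathlib

open MeasureTheory ProbabilityTheory Filter

noncomputable section

/-- The folded Cauchy law with scale `a`: the law on `ℝ` with density
`(2 / π) * a / (r ^ 2 + a ^ 2)` for `r > 0` and `0` for `r ≤ 0`. -/
def foldedCauchy (a : ℝ) : Measure ℝ :=
  (volume.restrict (Set.Ioi 0)).withDensity
    fun r => ENNReal.ofReal (2 / Real.pi * (a / (r ^ 2 + a ^ 2)))

/-- The uniform law on the interval `[0, 2π)`. -/
def uniformAngle : Measure ℝ :=
  ProbabilityTheory.cond volume (Set.Ico 0 (2 * Real.pi))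

/-- The circular bivariate Cauchy law with shape parameter `b`: the law on the plane with density
`b / (2 * π * (b ^ 2 + x₁ ^ 2 + x₂ ^ 2) ^ (3 / 2))`. -/
def circularCauchy (b : ℝ) : Measure (ℝ × ℝ) :=
  volume.withDensity fun x =>
    ENNReal.ofReal
      (1 / (2 * Real.pi) * (b / (b ^ 2 + x.1 ^ 2 + x.2 ^ 2) ^ (3 / 2 : ℝ)))

/-- The centred Gaussian law on the plane with independent components of variances
`v₁` and `v₂`. -/
def centredGaussian (v₁ v₂ : NNReal) : Measure (ℝ × ℝ) :=
  (gaussianReal 0 v₁).prod (gaussianReal 0 v₂)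

instance centredGaussian_isProbabilityMeasure (v₁ v₂ : NNReal) : IsProbabilityMeasure (centredGaussian v₁ v₂) := by
  unfold centredGaussian; infer_instance

/-- The position after the `n` steps `((R j + Δ₁) * cos (θ j), (R j + Δ₂) * sin (θ j))`. -/
def position {Ω : Type*} {n : ℕ} (Δ₁ Δ₂ : ℝ) (R θ : Fin n → Ω → ℝ) (ω : Ω) : ℝ × ℝ :=
  (∑ j, (R j ω + Δ₁) * Real.cos (θ j ω), ∑ j, (R j ω + Δ₂) * Real.sin (θ j ω))

end

open scoped Topology

/-! By Lévy's theorem it is enough that characteristic functions converge pointwise, and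
independence makes the one at `(α, β)` the `n`-th power of that of a single step. Given the angle
`θ`, the phase of a step is `s R + v n^(-1/2)` with `s = α cos θ + β sin θ` and `v = α C₁ cos θ + β
C₂ sin θ`. For the scale `a = c / n`, `c = π b / 2`, the mean of `cos (s R)` is exactly `exp (-a
|s|)`, since `R` is the modulus of a Cauchy variable. The mean of `sin (s R)` is only bounded, by a
multiple of `a^(3/4)` (`exists_abs_integral_sin_foldedCauchy_le`).

The symmetry `θ ↦ θ + π` makes the step's characteristic function real, so the sine mean enters only
multiplied by `sin (v n^(-1/2))`. That product has order at most `n^(-5/4)` and is negligible. Hence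
`n` times (characteristic function minus one) tends to the angular mean of `-c |s| - v² / 2`
(`tendsto_mul_step_sub_one`). As `|cos|` has mean `2 / π` and `cos²` has mean `1 / 2`, this is `-b
√(α² + β²) - (C₁² α² + C₂² β²) / 4`, the sum of the Cauchy and Gaussian exponents.

The circular Cauchy transform follows from rotation invariance: the frequency may be turned onto the
first axis, and the first marginal is a one-dimensional Cauchy law. -/

/-! ### The Fourier transform of the Cauchy law on the line -/

open scoped FourierTransform in
lemma fourier_exp_neg_mul_abs {c : ℝ} (hc : 0 < c) (w : ℝ) :
    𝓕 (fun x : ℝ => (Real.exp (-c * |x|) : ℂ)) w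
      = ((2 * c / (c ^ 2 + (2 * Real.pi * w) ^ 2) : ℝ) : ℂ) := by
  have h1 : (c + 2 * Real.pi * w * Complex.I : ℂ) ≠ 0 := by
    intro h; have := congrArg Complex.re h; simp at this; exact hc.ne' this
  have h2 : (c - 2 * Real.pi * w * Complex.I : ℂ) ≠ 0 := by
    intro h; have := congrArg Complex.re h; simp at this; exact hc.ne' this
  have h3 : ((c : ℂ) ^ 2 + (2 * Real.pi * w) ^ 2) ≠ 0 := by
    norm_cast; positivity
  -- On each half-line the integrand is a single complex exponential, with rate `p` on the right and
  -- `q` on the left.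
  set p : ℂ := -(c + 2 * Real.pi * w * Complex.I) with hp
  set q : ℂ := c - 2 * Real.pi * w * Complex.I with hq
  have hpre : p.re < 0 := by simp [hp, hc]
  have hqre : 0 < q.re := by simp [hq, hc]
  rw [Real.fourier_eq']
  have e1 : Set.EqOn (fun v : ℝ => Complex.exp (p * v)) (fun v : ℝ =>
      Complex.exp (↑(-2 * Real.pi * inner ℝ v w) * Complex.I) • (Real.exp (-c * |v|) : ℂ))
      (Set.Ioi 0) := by
    intro v hv
    simp only [smul_eq_mul, Complex.ofReal_exp, ← Complex.exp_add, abs_of_pos (Set.mem_Ioi.1 hv), hp]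
    congr 1; push_cast [RCLike.inner_apply]; simp; ring
  have e2 : Set.EqOn (fun v : ℝ => Complex.exp (q * v)) (fun v : ℝ =>
      Complex.exp (↑(-2 * Real.pi * inner ℝ v w) * Complex.I) • (Real.exp (-c * |v|) : ℂ))
      (Set.Iic 0) := by
    intro v hv
    simp only [smul_eq_mul, Complex.ofReal_exp, ← Complex.exp_add, abs_of_nonpos (Set.mem_Iic.1 hv), hq]
    congr 1; push_cast [RCLike.inner_apply]; simp; ring
  rw [← integral_add_compl (s := Set.Iic (0:ℝ)) measurableSet_Iic, Set.compl_Iic,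
    ← setIntegral_congr_fun measurableSet_Iic e2, ← setIntegral_congr_fun measurableSet_Ioi e1,
    integral_exp_mul_complex_Iic hqre, integral_exp_mul_complex_Ioi hpre]
  · have hp0 : p ≠ 0 := by rw [hp]; exact neg_ne_zero.2 h1
    simp only [Complex.ofReal_zero, mul_zero, Complex.exp_zero]
    push_cast
    rw [show (-1 / p : ℂ) = 1 / (c + 2 * Real.pi * w * Complex.I) by rw [hp, neg_div_neg_eq],
      div_add_div _ _ h2 h1, show q * (c + 2 * Real.pi * w * Complex.I)
        = (c : ℂ) ^ 2 + (2 * Real.pi * w) ^ 2 by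
          rw [hq]; linear_combination (-(2 * Real.pi * w : ℂ) ^ 2) * Complex.I_sq, hq]
    congr 1
    ring
  · rw [← integrableOn_univ, ← Set.Iic_union_Ioi (a := (0:ℝ)), integrableOn_union]
    exact ⟨(integrableOn_exp_mul_complex_Iic hqre 0).congr_fun e2 measurableSet_Iic,
      (integrableOn_exp_mul_complex_Ioi hpre 0).congr_fun e1 measurableSet_Ioi⟩

lemma integrable_exp_neg_mul_abs {c : ℝ} (hc : 0 < c) :
    Integrable (fun x : ℝ => (Real.exp (-c * |x|) : ℂ)) := by
  refine Integrable.ofReal (f := fun x : ℝ => Real.exp (-c * |x|)) ?_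
  rw [← integrableOn_univ, ← Set.Iic_union_Ioi (a := (0:ℝ)), integrableOn_union]
  refine ⟨(integrableOn_exp_mul_Iic hc 0).congr_fun ?_ measurableSet_Iic,
    (integrableOn_exp_mul_Ioi (neg_neg_of_pos hc) 0).congr_fun ?_ measurableSet_Ioi⟩
  · intro x hx; simp only [abs_of_nonpos (Set.mem_Iic.1 hx)]; congr 1; ring
  · intro x hx; simp only [abs_of_pos (Set.mem_Ioi.1 hx)]

lemma integrable_div_sq_add_sq {a : ℝ} (ha : 0 < a) :
    Integrable fun x : ℝ => a / (x ^ 2 + a ^ 2) := by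
  have := (integrable_cauchyPDFReal 0 (γ := ⟨a, ha.le⟩)).const_mul Real.pi
  refine this.congr (Eventually.of_forall fun x => ?_)
  simp only [cauchyPDFReal, sub_zero]
  change Real.pi * (Real.pi⁻¹ * a * (x ^ 2 + a ^ 2)⁻¹) = _
  have := Real.pi_pos
  field_simp

open scoped FourierTransform in
/-- The characteristic function of the Cauchy law. -/
lemma integral_exp_mul_div_sq_add_sq {a : ℝ} (ha : 0 < a) (t : ℝ) :
    ∫ x : ℝ, Complex.exp ((t * x : ℝ) * Complex.I) * ((a / (x ^ 2 + a ^ 2) : ℝ) : ℂ)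
      = ((Real.pi * Real.exp (-a * |t|) : ℝ) : ℂ) := by
  have hpi := Real.pi_pos
  have hc : 0 < 2 * Real.pi * a := by positivity
  have hF : 𝓕 (fun x : ℝ => (Real.exp (-(2 * Real.pi * a) * |x|) : ℂ))
      = fun w : ℝ => (((Real.pi)⁻¹ * (a / (w ^ 2 + a ^ 2)) : ℝ) : ℂ) := by
    ext w
    rw [fourier_exp_neg_mul_abs hc]
    congr 1
    have : 0 < w ^ 2 + a ^ 2 := by positivity
    have : 0 < (2 * Real.pi * a) ^ 2 + (2 * Real.pi * w) ^ 2 := by positivity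
    field_simp
    ring
  -- The rate `2πa` makes the transform of the two-sided exponential the Cauchy density of scale
  -- `a`; Fourier inversion at `t / (2π)` then gives the claim.
  have inv := Continuous.fourierInv_fourier_eq (f := fun x : ℝ =>
    (Real.exp (-(2 * Real.pi * a) * |x|) : ℂ)) (by fun_prop) (integrable_exp_neg_mul_abs hc)
    (by rw [hF]; exact ((integrable_div_sq_add_sq ha).const_mul _).ofReal)
  have h := congrFun inv (t / (2 * Real.pi))
  rw [hF, Real.fourierInv_eq'] at h
  have habs : -(2 * Real.pi * a) * |t / (2 * Real.pi)| = -a * |t| := by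
    rw [abs_div, abs_of_pos (show 0 < 2 * Real.pi by positivity)]; field_simp
  rw [habs] at h
  rw [Complex.ofReal_mul, ← h, ← integral_const_mul]
  refine integral_congr_ae (Eventually.of_forall fun x => ?_)
  simp only [smul_eq_mul]
  rw [show 2 * Real.pi * inner ℝ x (t / (2 * Real.pi)) = t * x by
    simp; field_simp]
  push_cast
  have : (Real.pi : ℂ) ≠ 0 := by exact_mod_cast hpi.ne'
  field_simp

lemma integral_cos_mul_div_sq_add_sq {a : ℝ} (ha : 0 < a) (t : ℝ) :
    ∫ x : ℝ, Real.cos (t * x) * (a / (x ^ 2 + a ^ 2)) = Real.pi * Real.exp (-a * |t|) := by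
  have h := congrArg Complex.re (integral_exp_mul_div_sq_add_sq ha t)
  rw [Complex.ofReal_re] at h
  rw [← h]
  have hi : Integrable (fun x : ℝ =>
      Complex.exp ((t * x : ℝ) * Complex.I) * ((a / (x ^ 2 + a ^ 2) : ℝ) : ℂ)) := by
    refine (integrable_div_sq_add_sq ha).ofReal.bdd_mul (c := 1) (by fun_prop) ?_
    exact Eventually.of_forall fun x => (Complex.norm_exp_ofReal_mul_I _).le
  have := integral_re hi
  simp only [RCLike.re_to_complex] at this
  rw [← this]
  refine integral_congr_ae (Eventually.of_forall fun x => ?_)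
  simp only [Complex.re_mul_ofReal, Complex.exp_ofReal_mul_I_re]

/-- The characteristic function of the Cauchy law, as an integral over the half-line. -/
lemma integral_Ioi_cos_mul_div_sq_add_sq {a : ℝ} (ha : 0 < a) (t : ℝ) :
    ∫ x in Set.Ioi 0, 2 / Real.pi * (a / (x ^ 2 + a ^ 2)) * Real.cos (t * x)
      = Real.exp (-a * |t|) := by
  have h := integral_comp_abs (f := fun x => Real.cos (t * x) * (a / (x ^ 2 + a ^ 2)))
  have hc : ∀ x, Real.cos (t * |x|) = Real.cos (t * x) := fun x => by
    rcases abs_choice x with h | h <;> simp [h]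
  simp only [sq_abs, hc] at h
  rw [integral_cos_mul_div_sq_add_sq ha] at h
  have hpi := Real.pi_pos
  calc _ = 2 / Real.pi * ∫ x in Set.Ioi 0, Real.cos (t * x) * (a / (x ^ 2 + a ^ 2)) := by
        rw [← integral_const_mul]; congr 1; ext x; ring
    _ = _ := by
        have : ∫ x in Set.Ioi 0, Real.cos (t * x) * (a / (x ^ 2 + a ^ 2))
          = Real.pi * Real.exp (-a * |t|) / 2 := by linarith
        rw [this]; field_simp

/-! ### Cosine and sine means of the folded Cauchy law -/

lemma integral_foldedCauchy {E : Type*} [NormedAddCommGroup E] [NormedSpace ℝ E] {a : ℝ}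
    (ha : 0 < a) (g : ℝ → E) :
    ∫ r, g r ∂(foldedCauchy a)
      = ∫ r in Set.Ioi 0, (2 / Real.pi * (a / (r ^ 2 + a ^ 2))) • g r := by
  unfold foldedCauchy
  rw [integral_withDensity_eq_integral_toReal_smul (by fun_prop) (by simp)]
  refine integral_congr_ae (Eventually.of_forall fun r => ?_)
  simp only
  rw [ENNReal.toReal_ofReal (by positivity)]

lemma integral_cos_mul_foldedCauchy {a : ℝ} (ha : 0 < a) (t : ℝ) :
    ∫ r, Real.cos (t * r) ∂(foldedCauchy a) = Real.exp (-a * |t|) := by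
  rw [integral_foldedCauchy ha]
  simpa only [smul_eq_mul] using integral_Ioi_cos_mul_div_sq_add_sq ha t

/-- Both `r` and `a` are at most `√(r² + a²)`, so `r^(7/4) a^(1/4) ≤ r² + a²`. This extracts
`a^(3/4)` and leaves a power of `r` that is integrable at infinity, and at `0` too once a factor `r`
is gained from the sine. -/
lemma div_sq_add_sq_le_rpow {a r : ℝ} (ha : 0 < a) (hr : 0 < r) :
    a / (r ^ 2 + a ^ 2) ≤ a ^ (3 / 4 : ℝ) * r ^ (-(7 / 4) : ℝ) := by
  set m := Real.sqrt (r ^ 2 + a ^ 2) with hm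
  have hmr : r ≤ m := Real.le_sqrt_of_sq_le (by nlinarith)
  have hma : a ≤ m := Real.le_sqrt_of_sq_le (by nlinarith)
  have hm0 : 0 < m := ha.trans_le hma
  have hsq : r ^ 2 + a ^ 2 = m ^ 2 := (Real.sq_sqrt (by positivity)).symm
  have key : r ^ (7 / 4 : ℝ) * a ^ (1 / 4 : ℝ) ≤ r ^ 2 + a ^ 2 := by
    rw [hsq, ← Real.rpow_natCast m 2, show ((2 : ℕ) : ℝ) = 7 / 4 + 1 / 4 by norm_num,
      Real.rpow_add hm0]
    gcongr
  rw [div_le_iff₀ (by positivity)]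
  calc a = a ^ (3 / 4 : ℝ) * r ^ (-(7 / 4) : ℝ) * (r ^ (7 / 4 : ℝ) * a ^ (1 / 4 : ℝ)) := by
        have h1 : r ^ (-(7 / 4) : ℝ) * r ^ (7 / 4 : ℝ) = 1 := by
          rw [← Real.rpow_add hr]; norm_num
        have h2 : a ^ (3 / 4 : ℝ) * a ^ (1 / 4 : ℝ) = a := by
          rw [← Real.rpow_add ha]; norm_num
        linear_combination (-a) * h1 - r ^ (-(7 / 4) : ℝ) * r ^ (7 / 4 : ℝ) * h2
    _ ≤ _ := by gcongr

/-- The mean of `sin (s * r)` under the folded Cauchy law is of order `a ^ (3 / 4)` at most. -/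
lemma exists_abs_integral_sin_foldedCauchy_le :
    ∃ K : ℝ, 0 ≤ K ∧ ∀ a : ℝ, 0 < a → ∀ s : ℝ,
      |∫ r, Real.sin (s * r) ∂(foldedCauchy a)| ≤ K * (1 + |s|) * a ^ (3 / 4 : ℝ) := by
  have hi1 : IntegrableOn (fun r : ℝ => r ^ (-(3 / 4) : ℝ)) (Set.Ioc 0 1) := by
    rw [← intervalIntegrable_iff_integrableOn_Ioc_of_le zero_le_one]
    exact intervalIntegral.intervalIntegrable_rpow' (by norm_num)
  have hi2 : IntegrableOn (fun r : ℝ => r ^ (-(7 / 4) : ℝ)) (Set.Ioi 1) :=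
    integrableOn_Ioi_rpow_of_lt (by norm_num) one_pos
  -- A majorant free of `a`: up to `1` it uses `|sin (s r)| ≤ |s| r`, beyond `1` it uses `|sin| ≤
  -- 1`.
  let B : ℝ → ℝ := fun r => if r ≤ 1 then r ^ (-(3 / 4) : ℝ) else r ^ (-(7 / 4) : ℝ)
  have hB : IntegrableOn B (Set.Ioi 0) := by
    rw [← Set.Ioc_union_Ioi_eq_Ioi zero_le_one, integrableOn_union]
    exact ⟨hi1.congr_fun (fun r hr => by simp [B, hr.2]) measurableSet_Ioc,
      hi2.congr_fun (fun r hr => by simp [B, not_le.2 (Set.mem_Ioi.1 hr)]) measurableSet_Ioi⟩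
  have hB0 : ∀ r ∈ Set.Ioi (0 : ℝ), 0 ≤ B r := fun r hr => by
    have : (0 : ℝ) < r := hr
    simp only [B]; split_ifs <;> positivity
  refine ⟨2 / Real.pi * ∫ r in Set.Ioi 0, B r,
    mul_nonneg (by positivity) (setIntegral_nonneg measurableSet_Ioi hB0), fun a ha s => ?_⟩
  rw [integral_foldedCauchy ha, ← Real.norm_eq_abs]
  have hle : ∀ r ∈ Set.Ioi (0 : ℝ), ‖(2 / Real.pi * (a / (r ^ 2 + a ^ 2))) • Real.sin (s * r)‖
      ≤ 2 / Real.pi * (1 + |s|) * a ^ (3 / 4 : ℝ) * B r := by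
    intro r hr
    have hr : 0 < r := hr
    have hs : 0 ≤ |s| := abs_nonneg s
    rw [norm_smul, Real.norm_eq_abs, Real.norm_eq_abs,
      abs_of_nonneg (show 0 ≤ 2 / Real.pi * (a / (r ^ 2 + a ^ 2)) by positivity)]
    have hd := div_sq_add_sq_le_rpow ha hr
    have hsin : r ^ (-(7 / 4) : ℝ) * |Real.sin (s * r)| ≤ (1 + |s|) * B r := by
      by_cases h : r ≤ 1
      · have h1 : |Real.sin (s * r)| ≤ |s| * r := by
          simpa [abs_mul, abs_of_pos hr] using Real.abs_sin_le_abs (x := s * r)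
        have h2 : r ^ (-(7 / 4) : ℝ) * r = r ^ (-(3 / 4) : ℝ) := by
          rw [← Real.rpow_add_one hr.ne']; norm_num
        simp only [B, h, if_true]
        calc _ ≤ r ^ (-(7 / 4) : ℝ) * (|s| * r) := by gcongr
          _ = |s| * r ^ (-(3 / 4) : ℝ) := by rw [← h2]; ring
          _ ≤ _ := by gcongr; linarith
      · simp only [B, h, if_false]
        rw [mul_comm]
        gcongr
        linarith [Real.abs_sin_le_one (s * r)]
    calc _ ≤ 2 / Real.pi * (a ^ (3 / 4 : ℝ) * r ^ (-(7 / 4) : ℝ)) * |Real.sin (s * r)| := by gcongr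
      _ = 2 / Real.pi * a ^ (3 / 4 : ℝ) * (r ^ (-(7 / 4) : ℝ) * |Real.sin (s * r)|) := by ring
      _ ≤ 2 / Real.pi * a ^ (3 / 4 : ℝ) * ((1 + |s|) * B r) := by gcongr
      _ = _ := by ring
  refine (norm_integral_le_of_norm_le (hB.const_mul _)
    ((ae_restrict_iff' measurableSet_Ioi).2 (Eventually.of_forall hle))).trans (le_of_eq ?_)
  rw [integral_const_mul]; ring

/-! ### The circular bivariate Cauchy law -/

lemma exists_polar_form (α β : ℝ) : ∃ ψ : ℝ,
    α = Real.sqrt (α ^ 2 + β ^ 2) * Real.cos ψ ∧ β = Real.sqrt (α ^ 2 + β ^ 2) * Real.sin ψ := by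
  have hn : ‖(⟨α, β⟩ : ℂ)‖ = Real.sqrt (α ^ 2 + β ^ 2) := by
    rw [Complex.norm_eq_sqrt_sq_add_sq]
  refine ⟨Complex.arg ⟨α, β⟩, ?_, ?_⟩ <;> rw [← hn]
  · exact (Complex.norm_mul_cos_arg ⟨α, β⟩).symm
  · exact (Complex.norm_mul_sin_arg ⟨α, β⟩).symm

lemma integrable_inv_add_sq_rpow {A : ℝ} (hA : 0 < A) :
    Integrable fun y : ℝ => 1 / (A + y ^ 2) ^ (3 / 2 : ℝ) := by
  have hs : 0 < Real.sqrt A := Real.sqrt_pos.2 hA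
  refine ((integrable_div_sq_add_sq hs).const_mul (1 / A)).mono' ?_
    (Eventually.of_forall fun y => ?_)
  · exact Measurable.aestronglyMeasurable (by fun_prop)
  · have hp : 0 < A + y ^ 2 := by positivity
    rw [Real.norm_of_nonneg (by positivity), Real.sq_sqrt hA.le,
      show (3 / 2 : ℝ) = 1 + 1 / 2 by norm_num, Real.rpow_add hp, Real.rpow_one,
      ← Real.sqrt_eq_rpow]
    have h1 : Real.sqrt A ≤ Real.sqrt (A + y ^ 2) := Real.sqrt_le_sqrt (by nlinarith [sq_nonneg y])
    calc 1 / ((A + y ^ 2) * Real.sqrt (A + y ^ 2)) ≤ 1 / ((A + y ^ 2) * Real.sqrt A) := by gcongr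
      _ = 1 / A * (Real.sqrt A / (y ^ 2 + A)) := by
        have := Real.sq_sqrt hA.le
        rw [add_comm (y ^ 2)]
        field_simp
        linarith

lemma tendsto_self_div_sqrt_add_sq {A : ℝ} (hA : 0 < A) :
    Tendsto (fun y : ℝ => y / Real.sqrt (A + y ^ 2)) atTop (𝓝 1) := by
  have h : Tendsto (fun y : ℝ => 1 / Real.sqrt (A * (y⁻¹) ^ 2 + 1)) atTop
      (𝓝 (1 / Real.sqrt (A * 0 ^ 2 + 1))) := by
    refine Tendsto.div tendsto_const_nhds (Tendsto.sqrt ?_) (by simp)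
    exact ((tendsto_inv_atTop_zero.pow 2).const_mul A).add_const 1
  simp only [ne_eq, OfNat.ofNat_ne_zero, not_false_eq_true, zero_pow, mul_zero, zero_add,
    Real.sqrt_one, div_one] at h
  refine h.congr' ?_
  filter_upwards [eventually_gt_atTop 0] with y hy
  have : A + y ^ 2 = y ^ 2 * (A * y⁻¹ ^ 2 + 1) := by field_simp
  rw [this, Real.sqrt_mul (by positivity), Real.sqrt_sq hy.le]
  have : 0 < Real.sqrt (A * y⁻¹ ^ 2 + 1) := Real.sqrt_pos.2 (by positivity)
  field_simp

/-- The antiderivative `y / (A √(A + y²))` tends to `±1 / A` at `±∞`. -/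
lemma integral_inv_add_sq_rpow {A : ℝ} (hA : 0 < A) :
    ∫ y : ℝ, 1 / (A + y ^ 2) ^ (3 / 2 : ℝ) = 2 / A := by
  have hd : ∀ y : ℝ, HasDerivAt (fun y : ℝ => y / Real.sqrt (A + y ^ 2) / A)
      (1 / (A + y ^ 2) ^ (3 / 2 : ℝ)) y := by
    intro y
    have hp : 0 < A + y ^ 2 := by positivity
    have hs : 0 < Real.sqrt (A + y ^ 2) := Real.sqrt_pos.2 hp
    have h1 : HasDerivAt (fun y : ℝ => A + y ^ 2) (2 * y) y := by
      simpa using ((hasDerivAt_id y).pow 2).const_add A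
    have h2 := ((hasDerivAt_id y).div (h1.sqrt hp.ne') hs.ne').div_const A
    convert! h2 using 1
    have hsq := Real.sq_sqrt hp.le
    rw [show (3 / 2 : ℝ) = 1 + 1 / 2 by norm_num, Real.rpow_add hp, Real.rpow_one,
      ← Real.sqrt_eq_rpow, hsq]
    simp only [id]
    field_simp
    rw [hsq]; ring
  have htop := (tendsto_self_div_sqrt_add_sq hA).div_const A
  have hbot : Tendsto (fun y : ℝ => y / Real.sqrt (A + y ^ 2) / A) atBot (𝓝 (-1 / A)) := by
    refine (((tendsto_self_div_sqrt_add_sq hA).neg).div_const A).comp tendsto_neg_atBot_atTop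
      |>.congr fun y => ?_
    simp [neg_div]
  rw [integral_of_hasDerivAt_of_tendsto hd (integrable_inv_add_sq_rpow hA) hbot htop]
  ring

/-- The density of the circular bivariate Cauchy law. -/
noncomputable def circularCauchyDensity (b : ℝ) (x : ℝ × ℝ) : ℝ :=
  1 / (2 * Real.pi) * (b / (b ^ 2 + x.1 ^ 2 + x.2 ^ 2) ^ (3 / 2 : ℝ))

lemma measurable_circularCauchyDensity (b : ℝ) : Measurable (circularCauchyDensity b) := by
  unfold circularCauchyDensity; fun_prop

lemma circularCauchyDensity_nonneg {b : ℝ} (hb : 0 < b) (x : ℝ × ℝ) :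
    0 ≤ circularCauchyDensity b x := by
  unfold circularCauchyDensity; positivity

lemma circularCauchyDensity_mk (b x y : ℝ) : circularCauchyDensity b (x, y)
    = b / (2 * Real.pi) * (1 / ((b ^ 2 + x ^ 2) + y ^ 2) ^ (3 / 2 : ℝ)) := by
  unfold circularCauchyDensity; ring

/-- The first marginal of the circular bivariate Cauchy law is a Cauchy law. -/
lemma integral_circularCauchyDensity_snd {b : ℝ} (hb : 0 < b) (x : ℝ) :
    ∫ y, circularCauchyDensity b (x, y) = Real.pi⁻¹ * (b / (x ^ 2 + b ^ 2)) := by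
  simp_rw [circularCauchyDensity_mk]
  rw [integral_const_mul, integral_inv_add_sq_rpow (by positivity), add_comm (b ^ 2)]
  have := Real.pi_pos
  field_simp

lemma integrable_circularCauchyDensity {b : ℝ} (hb : 0 < b) :
    Integrable (circularCauchyDensity b) := by
  rw [Measure.volume_eq_prod, integrable_prod_iff
    (measurable_circularCauchyDensity b).aestronglyMeasurable]
  constructor
  · refine Eventually.of_forall fun x => ?_
    simp_rw [circularCauchyDensity_mk]
    exact (integrable_inv_add_sq_rpow (by positivity)).const_mul _
  · simp_rw [Real.norm_of_nonneg (circularCauchyDensity_nonneg hb _),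
      integral_circularCauchyDensity_snd hb]
    exact (integrable_div_sq_add_sq hb).const_mul _

lemma integral_circularCauchy {E : Type*} [NormedAddCommGroup E] [NormedSpace ℝ E] {b : ℝ}
    (hb : 0 < b) (g : ℝ × ℝ → E) :
    ∫ x, g x ∂(circularCauchy b) = ∫ x, circularCauchyDensity b x • g x := by
  change ∫ x, g x ∂(volume.withDensity fun x => ENNReal.ofReal (circularCauchyDensity b x)) = _
  rw [integral_withDensity_eq_integral_toReal_smul
    (measurable_circularCauchyDensity b).ennreal_ofReal (by simp)]
  refine integral_congr_ae (Eventually.of_forall fun r => ?_)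
  simp only
  rw [ENNReal.toReal_ofReal (circularCauchyDensity_nonneg hb r)]

/-- For a frequency on the first axis, Fubini integrates out the second coordinate and leaves the
one-dimensional Cauchy transform. The case `t = 0` also yields the total mass. -/
lemma integral_exp_fst_circularCauchyDensity {b : ℝ} (hb : 0 < b) (t : ℝ) :
    ∫ x : ℝ × ℝ, circularCauchyDensity b x • Complex.exp ((t * x.1 : ℝ) * Complex.I)
      = ((Real.exp (-b * |t|) : ℝ) : ℂ) := by
  have hi : Integrable (fun x : ℝ × ℝ =>
      circularCauchyDensity b x • Complex.exp ((t * x.1 : ℝ) * Complex.I)) := by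
    refine (integrable_circularCauchyDensity hb).smul_bdd 1
      (Measurable.aestronglyMeasurable (by fun_prop)) ?_
    exact Eventually.of_forall fun x => (Complex.norm_exp_ofReal_mul_I _).le
  rw [Measure.volume_eq_prod] at hi ⊢
  rw [integral_prod _ hi]
  have hinner : ∀ x : ℝ, ∫ y, circularCauchyDensity b (x, y) •
      Complex.exp ((t * x : ℝ) * Complex.I)
      = ((Real.pi⁻¹ * (b / (x ^ 2 + b ^ 2)) : ℝ) : ℂ) * Complex.exp ((t * x : ℝ) * Complex.I) :=
    fun x => by rw [integral_smul_const, integral_circularCauchyDensity_snd hb, Complex.real_smul]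
  simp only [hinner]
  have := integral_exp_mul_div_sq_add_sq hb t
  calc _ = ∫ x : ℝ, ((Real.pi⁻¹ : ℝ) : ℂ) *
        (Complex.exp ((t * x : ℝ) * Complex.I) * ((b / (x ^ 2 + b ^ 2) : ℝ) : ℂ)) := by
        refine integral_congr_ae (Eventually.of_forall fun x => ?_)
        simp only [Complex.ofReal_mul]; ring
    _ = _ := by
        rw [integral_const_mul, this, ← Complex.ofReal_mul]
        congr 1
        have := Real.pi_pos
        field_simp

lemma isProbabilityMeasure_circularCauchy {b : ℝ} (hb : 0 < b) :
    IsProbabilityMeasure (circularCauchy b) := by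
  have h := congrArg Complex.re (integral_exp_fst_circularCauchyDensity hb 0)
  have h1 : ∫ x, circularCauchyDensity b x = 1 := by
    simp only [zero_mul, Complex.ofReal_zero, Complex.exp_zero, Complex.real_smul, mul_one,
      abs_zero, mul_zero, Real.exp_zero, integral_complex_ofReal, Complex.ofReal_re] at h
    exact h
  constructor
  change (volume.withDensity fun x => ENNReal.ofReal (circularCauchyDensity b x)) _ = _
  rw [withDensity_apply _ MeasurableSet.univ, setLIntegral_univ,
    ← ofReal_integral_eq_lintegral_ofReal (integrable_circularCauchyDensity hb)
      (Eventually.of_forall (circularCauchyDensity_nonneg hb)), h1, ENNReal.ofReal_one]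

/-- The rotation of the plane by the angle `-ψ`. -/
noncomputable def planeRotation (ψ : ℝ) : ℝ × ℝ →ₗ[ℝ] ℝ × ℝ :=
  Matrix.toLin (Module.Basis.finTwoProd ℝ) (Module.Basis.finTwoProd ℝ)
    !![Real.cos ψ, Real.sin ψ; -Real.sin ψ, Real.cos ψ]

lemma planeRotation_apply (ψ : ℝ) (x : ℝ × ℝ) : planeRotation ψ x =
    (Real.cos ψ * x.1 + Real.sin ψ * x.2, -Real.sin ψ * x.1 + Real.cos ψ * x.2) := by
  simp [planeRotation, Matrix.toLin_finTwoProd_apply]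

lemma map_planeRotation_volume (ψ : ℝ) :
    Measure.map (planeRotation ψ) (volume : Measure (ℝ × ℝ)) = volume := by
  have hdet : LinearMap.det (planeRotation ψ) = 1 := by
    rw [planeRotation, LinearMap.det_toLin, Matrix.det_fin_two_of]
    nlinarith [Real.sin_sq_add_cos_sq ψ]
  rw [Measure.map_linearMap_addHaar_eq_smul_addHaar volume (by rw [hdet]; exact one_ne_zero), hdet]
  simp

/-- The characteristic function of the circular bivariate Cauchy law. -/
lemma integral_exp_circularCauchy {b : ℝ} (hb : 0 < b) (α β : ℝ) :
    ∫ x, Complex.exp ((α * x.1 + β * x.2 : ℝ) * Complex.I) ∂(circularCauchy b)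
      = ((Real.exp (-b * Real.sqrt (α ^ 2 + β ^ 2)) : ℝ) : ℂ) := by
  obtain ⟨ψ, hα, hβ⟩ := exists_polar_form α β
  set ρ := Real.sqrt (α ^ 2 + β ^ 2)
  have hρ : |ρ| = ρ := abs_of_nonneg (Real.sqrt_nonneg _)
  rw [integral_circularCauchy hb, ← hρ, ← integral_exp_fst_circularCauchyDensity hb]
  -- Rotate the integral for the frequency `(ρ, 0)`: the density depends only on the radius, and `ρ`
  -- times the first rotated coordinate is `α x₁ + β x₂`.
  conv_rhs => rw [← map_planeRotation_volume ψ]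
  have hm : Measurable (planeRotation ψ) :=
    (LinearMap.continuous_of_finiteDimensional _).measurable
  rw [integral_map hm.aemeasurable]
  · refine integral_congr_ae (Eventually.of_forall fun x => ?_)
    simp only [planeRotation_apply]
    congr 1
    · unfold circularCauchyDensity
      have : (Real.cos ψ * x.1 + Real.sin ψ * x.2) ^ 2 + (-Real.sin ψ * x.1 + Real.cos ψ * x.2) ^ 2
          = x.1 ^ 2 + x.2 ^ 2 := by
        linear_combination (x.1 ^ 2 + x.2 ^ 2) * Real.sin_sq_add_cos_sq ψ
      simp only [add_assoc, this]
    · congr 3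
      rw [hα, hβ]; ring
  · refine Measurable.aestronglyMeasurable ?_
    exact (measurable_circularCauchyDensity b).smul (by fun_prop)

/-! ### Total masses and averages over the uniform angle -/

lemma isProbabilityMeasure_foldedCauchy {a : ℝ} (ha : 0 < a) :
    IsProbabilityMeasure (foldedCauchy a) := by
  have h := integral_cos_mul_foldedCauchy ha 0
  simp only [zero_mul, Real.cos_zero, integral_const, smul_eq_mul, mul_one, abs_zero, mul_zero,
    Real.exp_zero, Measure.real] at h
  exact ⟨(ENNReal.toReal_eq_one_iff _).1 h⟩

instance isProbabilityMeasure_uniformAngle : IsProbabilityMeasure uniformAngle := by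
  refine cond_isProbabilityMeasure_of_finite ?_ ?_
  · simp [Real.pi_pos]
  · rw [Real.volume_Ico]; exact ENNReal.ofReal_ne_top

lemma integral_uniformAngle {E : Type*} [NormedAddCommGroup E] [NormedSpace ℝ E] (f : ℝ → E) :
    ∫ θ, f θ ∂uniformAngle = (2 * Real.pi)⁻¹ • ∫ θ in (0 : ℝ)..(2 * Real.pi), f θ := by
  have h : (0 : ℝ) ≤ 2 * Real.pi := by positivity
  rw [uniformAngle, ProbabilityTheory.cond, integral_smul_measure, integral_Ico_eq_integral_Ioc,
    intervalIntegral.integral_of_le h]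
  simp [Real.pi_pos.le]

/-- Rotation invariance of the uniform angle. It removes phases from shifted cosines and later
justifies the shift by `π`. -/
lemma integral_uniformAngle_comp_add {E : Type*} [NormedAddCommGroup E] [NormedSpace ℝ E]
    {f : ℝ → E} (hf : Function.Periodic f (2 * Real.pi)) (c : ℝ) :
    ∫ θ, f (θ + c) ∂uniformAngle = ∫ θ, f θ ∂uniformAngle := by
  rw [integral_uniformAngle, integral_uniformAngle, intervalIntegral.integral_comp_add_right,
    zero_add, add_comm (2 * Real.pi), hf.intervalIntegral_add_eq c 0, zero_add]

lemma integral_abs_cos_uniformAngle : ∫ θ, |Real.cos θ| ∂uniformAngle = 2 / Real.pi := by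
  have hper : Function.Periodic (fun θ => |Real.cos θ|) Real.pi := fun θ => by
    simp [Real.cos_add_pi]
  have hper2 : Function.Periodic (fun θ => |Real.cos θ|) (2 * Real.pi) := fun θ => by simp
  have hint : ∀ a b, IntervalIntegrable (fun θ => |Real.cos θ|) volume a b := fun a b =>
    (Real.continuous_cos.abs).intervalIntegrable a b
  have hhalf : ∫ θ in (-(Real.pi / 2))..(Real.pi / 2), |Real.cos θ| = 2 := by
    have : ∫ θ in (-(Real.pi / 2))..(Real.pi / 2), |Real.cos θ|
        = ∫ θ in (-(Real.pi / 2))..(Real.pi / 2), Real.cos θ := by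
      refine intervalIntegral.integral_congr fun θ hθ => ?_
      rw [Set.uIcc_of_le (by linarith [Real.pi_pos])] at hθ
      exact abs_of_nonneg (Real.cos_nonneg_of_mem_Icc hθ)
    rw [this, integral_cos]; simp; norm_num
  -- The full turn is moved to start at `-π/2`, where it splits into two periods of `|cos|`, each of
  -- integral `2`.
  have h1 := hper2.intervalIntegral_add_eq 0 (-(Real.pi / 2))
  have h2 := hper.intervalIntegral_add_eq (Real.pi / 2) (-(Real.pi / 2))
  rw [show -(Real.pi / 2) + Real.pi = Real.pi / 2 by ring, hhalf] at h2
  rw [zero_add, show -(Real.pi / 2) + 2 * Real.pi = Real.pi / 2 + Real.pi by ring,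
    ← intervalIntegral.integral_add_adjacent_intervals 
      (hint (-(Real.pi / 2)) (Real.pi / 2)) (hint _ (Real.pi / 2 + Real.pi)),
    hhalf, h2] at h1
  rw [integral_uniformAngle, h1, smul_eq_mul]
  have := Real.pi_pos
  field_simp; norm_num

lemma integral_cos_sq_uniformAngle : ∫ θ, Real.cos θ ^ 2 ∂uniformAngle = 1 / 2 := by
  rw [integral_uniformAngle, integral_cos_sq]
  have := Real.pi_pos
  simp
  field_simp

/-- A linear combination of cosine and sine is a shifted cosine. -/
lemma exists_mul_cos_add_mul_sin_eq (α β : ℝ) : ∃ ψ : ℝ, ∀ θ,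
    α * Real.cos θ + β * Real.sin θ = Real.sqrt (α ^ 2 + β ^ 2) * Real.cos (θ + ψ) := by
  obtain ⟨ψ, h1, h2⟩ := exists_polar_form α β
  refine ⟨-ψ, fun θ => ?_⟩
  rw [Real.cos_add, Real.cos_neg, Real.sin_neg]
  linear_combination Real.cos θ * h1 + Real.sin θ * h2

/-- A shifted cosine of amplitude `√(α² + β²)`, whose phase rotation invariance absorbs. The factor
`2 / π` is what the `π / 2` in the scale of the radii cancels. -/
lemma integral_abs_mul_cos_add_mul_sin (α β : ℝ) :
    ∫ θ, |α * Real.cos θ + β * Real.sin θ| ∂uniformAngle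
      = Real.sqrt (α ^ 2 + β ^ 2) * (2 / Real.pi) := by
  obtain ⟨ψ, h⟩ := exists_mul_cos_add_mul_sin_eq α β
  simp_rw [h, abs_mul, abs_of_nonneg (Real.sqrt_nonneg _)]
  rw [integral_const_mul,
    integral_uniformAngle_comp_add (f := fun θ => |Real.cos θ|) (fun θ => by simp),
    integral_abs_cos_uniformAngle]

lemma integral_sq_mul_cos_add_mul_sin (α β : ℝ) :
    ∫ θ, (α * Real.cos θ + β * Real.sin θ) ^ 2 ∂uniformAngle = (α ^ 2 + β ^ 2) / 2 := by
  obtain ⟨ψ, h⟩ := exists_mul_cos_add_mul_sin_eq α β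
  simp_rw [h, mul_pow, Real.sq_sqrt (show 0 ≤ α ^ 2 + β ^ 2 by positivity)]
  rw [integral_const_mul,
    integral_uniformAngle_comp_add (f := fun θ => Real.cos θ ^ 2) (fun θ => by simp),
    integral_cos_sq_uniformAngle]
  ring

lemma abs_mul_cos_add_mul_sin_le (α β θ : ℝ) :
    |α * Real.cos θ + β * Real.sin θ| ≤ |α| + |β| := by
  refine (abs_add_le _ _).trans ?_
  rw [abs_mul, abs_mul]
  exact add_le_add (mul_le_of_le_one_right (abs_nonneg _) (Real.abs_cos_le_one θ))
    (mul_le_of_le_one_right (abs_nonneg _) (Real.abs_sin_le_one θ))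

/-! ### The characteristic function of one step -/

/-- The mean of `exp (i * (s * r + u))` under the folded Cauchy law. -/
lemma integral_exp_foldedCauchy {a : ℝ} (ha : 0 < a) (s u : ℝ) :
    ∫ r, Complex.exp ((s * r + u : ℝ) * Complex.I) ∂(foldedCauchy a)
      = ((Real.exp (-a * |s|) : ℝ) + (∫ r, Real.sin (s * r) ∂(foldedCauchy a) : ℝ) * Complex.I)
        * Complex.exp (u * Complex.I) := by
  have := isProbabilityMeasure_foldedCauchy ha
  have hc : Integrable (fun r => Real.cos (s * r)) (foldedCauchy a) :=
    Integrable.of_bound (Measurable.aestronglyMeasurable (by fun_prop)) 1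
      (Eventually.of_forall fun r => Real.abs_cos_le_one _)
  have hs : Integrable (fun r => Real.sin (s * r)) (foldedCauchy a) :=
    Integrable.of_bound (Measurable.aestronglyMeasurable (by fun_prop)) 1
      (Eventually.of_forall fun r => Real.abs_sin_le_one _)
  have h : ∀ r : ℝ, Complex.exp ((s * r + u : ℝ) * Complex.I)
      = (((Real.cos (s * r) : ℝ) : ℂ) + ((Real.sin (s * r) : ℝ) : ℂ) * Complex.I)
        * Complex.exp (u * Complex.I) := fun r => by
    rw [Complex.ofReal_add, add_mul, Complex.exp_add, Complex.exp_mul_I (s * r : ℝ),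
      Complex.ofReal_cos, Complex.ofReal_sin]
  simp_rw [h]
  rw [integral_mul_const, integral_add hc.ofReal (hs.ofReal.mul_const _), integral_mul_const,
    integral_complex_ofReal, integral_complex_ofReal, integral_cos_mul_foldedCauchy ha]

/-- The characteristic function of a planar step, for a polar radius with the folded Cauchy law and
an independent uniform polar angle. -/
lemma integral_uniformAngle_integral_exp_foldedCauchy {a : ℝ} (ha : 0 < a) (α β γ δ : ℝ) :
    ∫ θ, ∫ r, Complex.exp (((α * Real.cos θ + β * Real.sin θ) * r
        + (γ * Real.cos θ + δ * Real.sin θ) : ℝ) * Complex.I) ∂(foldedCauchy a) ∂uniformAngle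
      = ((∫ θ, (Real.exp (-a * |α * Real.cos θ + β * Real.sin θ|)
            * Real.cos (γ * Real.cos θ + δ * Real.sin θ)
          - (∫ r, Real.sin ((α * Real.cos θ + β * Real.sin θ) * r) ∂(foldedCauchy a))
            * Real.sin (γ * Real.cos θ + δ * Real.sin θ)) ∂uniformAngle : ℝ) : ℂ) := by
  have := isProbabilityMeasure_foldedCauchy ha
  set F : ℝ → ℂ := fun θ => ∫ r, Complex.exp (((α * Real.cos θ + β * Real.sin θ) * r
        + (γ * Real.cos θ + δ * Real.sin θ) : ℝ) * Complex.I) ∂(foldedCauchy a) with hF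
  -- A half turn changes the sign of the whole phase, hence conjugates `F`; by rotation invariance
  -- its mean is real, so only real parts need computing.
  have hconj : ∀ θ, F (θ + Real.pi) = starRingEnd ℂ (F θ) := fun θ => by
    simp only [hF, ← integral_conj, ← Complex.exp_conj, map_mul, Complex.conj_I,
      Complex.conj_ofReal, Real.cos_add_pi, Real.sin_add_pi]
    congr 1; ext r; congr 1; push_cast; ring
  have hper : Function.Periodic F (2 * Real.pi) := fun θ => by
    simp only [hF, Real.cos_add_two_pi, Real.sin_add_two_pi]
  have hFm : StronglyMeasurable F := by
    refine StronglyMeasurable.integral_prod_right' (f := fun p : ℝ × ℝ =>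
      Complex.exp (((α * Real.cos p.1 + β * Real.sin p.1) * p.2
        + (γ * Real.cos p.1 + δ * Real.sin p.1) : ℝ) * Complex.I)) ?_
    exact Measurable.stronglyMeasurable (by fun_prop)
  have hFi : Integrable F uniformAngle := by
    refine Integrable.of_bound hFm.aestronglyMeasurable 1 (Eventually.of_forall fun θ => ?_)
    refine (norm_integral_le_of_norm_le_const (C := 1) (Eventually.of_forall fun r =>
      (Complex.norm_exp_ofReal_mul_I _).le)).trans (by simp)
  have hreal : starRingEnd ℂ (∫ θ, F θ ∂uniformAngle) = ∫ θ, F θ ∂uniformAngle := by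
    rw [← integral_conj, ← integral_uniformAngle_comp_add hper Real.pi]
    simp_rw [hconj]
  rw [← Complex.conj_eq_iff_re.1 hreal]
  congr 1
  have hre := integral_re hFi
  simp only [RCLike.re_to_complex] at hre
  rw [← hre]
  refine integral_congr_ae (Eventually.of_forall fun θ => ?_)
  simp only [hF]
  rw [integral_exp_foldedCauchy ha]
  rw [Complex.mul_re, Complex.exp_ofReal_mul_I_re, Complex.exp_ofReal_mul_I_im]
  simp only [Complex.add_re, Complex.add_im, Complex.ofReal_re, Complex.ofReal_im, Complex.mul_re,
    Complex.mul_im, Complex.I_re, Complex.I_im, mul_zero, mul_one, sub_zero, add_zero, zero_add]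

/-! ### First-order asymptotics of one step -/

lemma tendsto_natCast_rpow_neg_half : Tendsto (fun n : ℕ => (n : ℝ) ^ (-(1 / 2) : ℝ)) atTop (𝓝 0) :=
  (tendsto_rpow_neg_atTop (by norm_num)).comp tendsto_natCast_atTop_atTop

lemma natCast_rpow_neg_half_sq (n : ℕ) : ((n : ℝ) ^ (-(1 / 2) : ℝ)) ^ 2 = (n : ℝ)⁻¹ := by
  rw [← Real.rpow_natCast, ← Real.rpow_mul (Nat.cast_nonneg n)]
  norm_num [Real.rpow_neg_one]

lemma tendsto_mul_exp_neg_div_sub_one (y : ℝ) :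
    Tendsto (fun n : ℕ => (n : ℝ) * (Real.exp (-(y / n)) - 1)) atTop (𝓝 (-y)) := by
  have hy : Tendsto (fun n : ℕ => y / (n : ℝ)) atTop (𝓝 0) :=
    tendsto_const_div_atTop_nhds_zero_nat y
  have hb : Tendsto (fun n : ℕ => y ^ 2 / (n : ℝ)) atTop (𝓝 0) :=
    tendsto_const_div_atTop_nhds_zero_nat _
  rw [tendsto_iff_norm_sub_tendsto_zero]
  refine squeeze_zero' (Eventually.of_forall fun n => norm_nonneg _) ?_ hb
  have hsmall := hy.abs.eventually (gt_mem_nhds (show |(0 : ℝ)| < 1 by simp))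
  filter_upwards [hsmall, eventually_gt_atTop 0] with n hn hn0
  have hn0 : (0 : ℝ) < n := by exact_mod_cast hn0
  have h := Real.abs_exp_sub_one_sub_id_le (x := -(y / n)) (by rw [abs_neg]; exact hn.le)
  rw [Real.norm_eq_abs]
  calc _ = |(n : ℝ) * (Real.exp (-(y / n)) - 1 - -(y / n))| := by congr 1; field_simp
    _ ≤ n * (-(y / n)) ^ 2 := by rw [abs_mul, abs_of_pos hn0]; gcongr
    _ = _ := by field_simp

lemma tendsto_mul_cos_sub_one (v : ℝ) :
    Tendsto (fun n : ℕ => (n : ℝ) * (Real.cos (v * (n : ℝ) ^ (-(1 / 2) : ℝ)) - 1)) atTop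
      (𝓝 (-(v ^ 2 / 2))) := by
  have hy : Tendsto (fun n : ℕ => v * (n : ℝ) ^ (-(1 / 2) : ℝ)) atTop (𝓝 0) := by
    simpa using tendsto_natCast_rpow_neg_half.const_mul v
  have hb : Tendsto (fun n : ℕ => v ^ 4 * (5 / 96) / (n : ℝ)) atTop (𝓝 0) :=
    tendsto_const_div_atTop_nhds_zero_nat _
  rw [tendsto_iff_norm_sub_tendsto_zero]
  refine squeeze_zero' (Eventually.of_forall fun n => norm_nonneg _) ?_ hb
  have hsmall := hy.abs.eventually (gt_mem_nhds (show |(0 : ℝ)| < 1 by simp))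
  filter_upwards [hsmall, eventually_gt_atTop 0] with n hn hn0
  have hn0 : (0 : ℝ) < n := by exact_mod_cast hn0
  have h := Real.cos_bound hn.le
  have hsq := natCast_rpow_neg_half_sq n
  set w := (n : ℝ) ^ (-(1 / 2) : ℝ)
  have hnw : (n : ℝ) * w ^ 2 = 1 := by rw [hsq]; field_simp
  rw [Real.norm_eq_abs]
  calc _ = |(n : ℝ) * (Real.cos (v * w) - (1 - (v * w) ^ 2 / 2))| := by
        congr 1; linear_combination (-v ^ 2 / 2) * hnw
    _ ≤ n * (|v * w| ^ 4 * (5 / 96)) := by rw [abs_mul, abs_of_pos hn0]; gcongr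
    _ = n * w ^ 2 * (v ^ 4 * (5 / 96) * w ^ 2) := by
        rw [Even.pow_abs (by decide)]; ring
    _ = _ := by rw [hnw, hsq]; field_simp

lemma tendsto_mul_exp_mul_cos_sub_one (y v : ℝ) :
    Tendsto (fun n : ℕ => (n : ℝ) * (Real.exp (-(y / n))
      * Real.cos (v * (n : ℝ) ^ (-(1 / 2) : ℝ)) - 1)) atTop (𝓝 (-y - v ^ 2 / 2)) := by
  have hc : Tendsto (fun n : ℕ => Real.cos (v * (n : ℝ) ^ (-(1 / 2) : ℝ))) atTop (𝓝 1) := by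
    have : Tendsto (fun n : ℕ => v * (n : ℝ) ^ (-(1 / 2) : ℝ)) atTop (𝓝 0) := by
      simpa using tendsto_natCast_rpow_neg_half.const_mul v
    have h := (Real.continuous_cos.tendsto 0).comp this
    rwa [Real.cos_zero] at h
  -- Uses `e cos - 1 = (e - 1) cos + (cos - 1)`.
  have h := ((tendsto_mul_exp_neg_div_sub_one y).mul hc).add (tendsto_mul_cos_sub_one v)
  rw [mul_one, ← sub_eq_add_neg] at h
  exact h.congr fun n => by ring

/-- The bound does not depend on `n`, as dominated convergence over the angle requires. It comes
from `exp (-x) ≥ 1 - x` and `cos x ≥ 1 - x² / 2`; `w` stands for `n^(-1/2)`. -/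
lemma abs_mul_exp_mul_cos_sub_one_le {n y w : ℝ} (v : ℝ) (hn : 0 < n) (hy : 0 ≤ y)
    (hw : w ^ 2 = n⁻¹) :
    |n * (Real.exp (-(y / n)) * Real.cos (v * w) - 1)| ≤ y + v ^ 2 / 2 := by
  have h1 : Real.exp (-(y / n)) ≤ 1 := Real.exp_le_one_iff.2 (by simp; positivity)
  have h2 : -(y / n) + 1 ≤ Real.exp (-(y / n)) := Real.add_one_le_exp _
  have h3 := Real.one_sub_sq_div_two_le_cos (x := v * w)
  have h4 := Real.cos_le_one (v * w)
  have h0 := Real.exp_pos (-(y / n))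
  have h5 : Real.exp (-(y / n)) * Real.cos (v * w) ≤ 1 := by nlinarith
  rw [mul_pow, hw] at h3
  have h6 : 1 - Real.exp (-(y / n)) * Real.cos (v * w) ≤ y / n + v ^ 2 * n⁻¹ / 2 := by
    nlinarith
  rw [abs_of_nonpos (mul_nonpos_of_nonneg_of_nonpos hn.le (by linarith))]
  calc _ = n * (1 - Real.exp (-(y / n)) * Real.cos (v * w)) := by ring
    _ ≤ n * (y / n + v ^ 2 * n⁻¹ / 2) := by gcongr
    _ = _ := by field_simp

/-- Power count for the sine cross term after multiplication by `n`. Any exponent above `1/2` in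
place of `3/4` would still leave a negative power of `n`. -/
lemma mul_div_rpow_mul_rpow_eq {n c : ℝ} (hn : 0 < n) (hc : 0 < c) :
    n * ((c / n) ^ (3 / 4 : ℝ) * n ^ (-(1 / 2) : ℝ)) = c ^ (3 / 4 : ℝ) * n ^ (-(1 / 4) : ℝ) := by
  rw [Real.div_rpow hc.le hn.le, div_eq_mul_inv, ← Real.rpow_neg hn.le]
  calc _ = c ^ (3 / 4 : ℝ) * (n ^ (1 : ℝ) * n ^ (-(3 / 4) : ℝ) * n ^ (-(1 / 2) : ℝ)) := by
        rw [Real.rpow_one]; ring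
    _ = _ := by rw [← Real.rpow_add hn, ← Real.rpow_add hn]; norm_num

/-- The first-order expansion of the characteristic function of a step. -/
lemma tendsto_mul_step_sub_one {c : ℝ} (hc : 0 < c) (α β γ δ : ℝ) :
    Tendsto (fun n : ℕ => (n : ℝ) *
        ((∫ θ, (Real.exp (-(c / n) * |α * Real.cos θ + β * Real.sin θ|)
            * Real.cos ((γ * (n : ℝ) ^ (-(1 / 2) : ℝ)) * Real.cos θ
              + (δ * (n : ℝ) ^ (-(1 / 2) : ℝ)) * Real.sin θ)
          - (∫ r, Real.sin ((α * Real.cos θ + β * Real.sin θ) * r) ∂(foldedCauchy (c / n)))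
            * Real.sin ((γ * (n : ℝ) ^ (-(1 / 2) : ℝ)) * Real.cos θ
              + (δ * (n : ℝ) ^ (-(1 / 2) : ℝ)) * Real.sin θ)) ∂uniformAngle) - 1)) atTop
      (𝓝 (-(c * (Real.sqrt (α ^ 2 + β ^ 2) * (2 / Real.pi))) - (γ ^ 2 + δ ^ 2) / 4)) := by
  obtain ⟨K, hK0, hK⟩ := exists_abs_integral_sin_foldedCauchy_le
  set s : ℝ → ℝ := fun θ => α * Real.cos θ + β * Real.sin θ with hs
  set v : ℝ → ℝ := fun θ => γ * Real.cos θ + δ * Real.sin θ with hv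
  set w : ℕ → ℝ := fun n => (n : ℝ) ^ (-(1 / 2) : ℝ) with hw
  have hw0 : ∀ n, 0 ≤ w n := fun n => by simp only [hw]; positivity
  have hsm : Measurable s := by fun_prop
  have hvm : Measurable v := by fun_prop
  have hsM : ∀ θ, |s θ| ≤ |α| + |β| := abs_mul_cos_add_mul_sin_le α β
  have hvM : ∀ θ, |v θ| ≤ |γ| + |δ| := abs_mul_cos_add_mul_sin_le γ δ
  set M := |α| + |β|
  set N := |γ| + |δ|
  have hM0 : 0 ≤ M := (abs_nonneg _).trans (hsM 0)
  have hN0 : 0 ≤ N := (abs_nonneg _).trans (hvM 0)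
  have hu : ∀ (n : ℕ) θ, (γ * (n : ℝ) ^ (-(1 / 2) : ℝ)) * Real.cos θ
      + (δ * (n : ℝ) ^ (-(1 / 2) : ℝ)) * Real.sin θ = v θ * w n := fun n θ => by
    simp only [hv, hw]; ring
  simp_rw [hu]
  set S : ℕ → ℝ → ℝ := fun n θ => ∫ r, Real.sin (s θ * r) ∂(foldedCauchy (c / n)) with hS
  have hSw : ∀ n : ℕ, 0 < n → ∀ θ, |(n : ℝ) * (S n θ * Real.sin (v θ * w n))|
      ≤ K * (1 + M) * N * c ^ (3 / 4 : ℝ) * (n : ℝ) ^ (-(1 / 4) : ℝ) := by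
    intro n hn θ
    have hn' : (0 : ℝ) < n := by exact_mod_cast hn
    have h1 : |S n θ| ≤ K * (1 + M) * (c / n) ^ (3 / 4 : ℝ) :=
      (hK (c / n) (by positivity) (s θ)).trans (by gcongr; exact hsM θ)
    have h2 : |Real.sin (v θ * w n)| ≤ N * w n := by
      refine Real.abs_sin_le_abs.trans ?_
      rw [abs_mul, abs_of_nonneg (hw0 n)]
      exact mul_le_mul_of_nonneg_right (hvM θ) (hw0 n)
    rw [abs_mul, abs_mul, abs_of_pos hn']
    calc _ ≤ n * (K * (1 + M) * (c / n) ^ (3 / 4 : ℝ) * (N * w n)) := by gcongr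
      _ = K * (1 + M) * N * (n * ((c / n) ^ (3 / 4 : ℝ) * w n)) := by ring
      _ = _ := by simp only [hw]; rw [mul_div_rpow_mul_rpow_eq hn' hc]; ring
  have hSm : ∀ n : ℕ, 0 < n → Measurable (S n) := by
    intro n hn
    have := isProbabilityMeasure_foldedCauchy (a := c / n) (by positivity)
    refine (StronglyMeasurable.integral_prod_right' (f := fun p : ℝ × ℝ =>
      Real.sin (s p.1 * p.2)) (Measurable.stronglyMeasurable (by fun_prop))).measurable
  -- The rescaled deviation from `1`, taken inside the angular integral; the `-1` may be moved
  -- inside because the angle has total mass one.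
  set G : ℕ → ℝ → ℝ := fun n θ => (n : ℝ) * (Real.exp (-(c * |s θ| / n)) * Real.cos (v θ * w n) - 1)
    - (n : ℝ) * (S n θ * Real.sin (v θ * w n)) with hG
  have hGm : ∀ n : ℕ, 0 < n → Measurable (G n) := fun n hn => by
    have := hSm n hn
    simp only [hG]; fun_prop
  have hGb : ∀ n : ℕ, 0 < n → ∀ θ, ‖G n θ‖
      ≤ (c * M + N ^ 2 / 2) + K * (1 + M) * N * c ^ (3 / 4 : ℝ) := by
    intro n hn θ
    have hn' : (0 : ℝ) < n := by exact_mod_cast hn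
    have h1 := abs_mul_exp_mul_cos_sub_one_le (y := c * |s θ|) (v θ) hn' (by positivity)
      (natCast_rpow_neg_half_sq n)
    have h2 : v θ ^ 2 ≤ N ^ 2 := by rw [← sq_abs]; gcongr; exact hvM θ
    have h3 : c * |s θ| ≤ c * M := by gcongr; exact hsM θ
    have h4 : (n : ℝ) ^ (-(1 / 4) : ℝ) ≤ 1 :=
      Real.rpow_le_one_of_one_le_of_nonpos (by exact_mod_cast hn) (by norm_num)
    have h5 : K * (1 + M) * N * c ^ (3 / 4 : ℝ) * (n : ℝ) ^ (-(1 / 4) : ℝ)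
        ≤ K * (1 + M) * N * c ^ (3 / 4 : ℝ) := mul_le_of_le_one_right (by positivity) h4
    have h6 := hSw n hn θ
    refine (norm_sub_le _ _).trans ?_
    rw [Real.norm_eq_abs, Real.norm_eq_abs]
    linarith
  have hGlim : ∀ θ, Tendsto (fun n => G n θ) atTop (𝓝 (-(c * |s θ|) - v θ ^ 2 / 2)) := by
    intro θ
    have h1 := tendsto_mul_exp_mul_cos_sub_one (c * |s θ|) (v θ)
    have h2 : Tendsto (fun n : ℕ => (n : ℝ) * (S n θ * Real.sin (v θ * w n))) atTop (𝓝 0) := by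
      refine squeeze_zero_norm' (a := fun n : ℕ =>
        K * (1 + M) * N * c ^ (3 / 4 : ℝ) * (n : ℝ) ^ (-(1 / 4) : ℝ)) ?_ ?_
      · filter_upwards [eventually_gt_atTop 0] with n hn using hSw n hn θ
      · simpa using ((tendsto_rpow_neg_atTop (y := 1 / 4) (by norm_num)).comp
          tendsto_natCast_atTop_atTop).const_mul (K * (1 + M) * N * c ^ (3 / 4 : ℝ))
    have h3 := h1.sub h2
    rwa [sub_zero] at h3
  have hdct := tendsto_integral_filter_of_dominated_convergence (μ := uniformAngle) (l := atTop)
    (F := G) (f := fun θ => -(c * |s θ|) - v θ ^ 2 / 2)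
    (fun _ => (c * M + N ^ 2 / 2) + K * (1 + M) * N * c ^ (3 / 4 : ℝ))
    (by filter_upwards [eventually_gt_atTop 0] with n hn using (hGm n hn).aestronglyMeasurable)
    (by filter_upwards [eventually_gt_atTop 0] with n hn using Eventually.of_forall (hGb n hn))
    (integrable_const _) (Eventually.of_forall hGlim)
  have hlim : ∫ θ, (-(c * |s θ|) - v θ ^ 2 / 2) ∂uniformAngle
      = -(c * (Real.sqrt (α ^ 2 + β ^ 2) * (2 / Real.pi))) - (γ ^ 2 + δ ^ 2) / 4 := by
    have hi1 : Integrable (fun θ => |s θ|) uniformAngle :=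
      Integrable.of_bound (by fun_prop) M (Eventually.of_forall fun θ => by simpa using hsM θ)
    have hi2 : Integrable (fun θ => v θ ^ 2) uniformAngle := by
      refine Integrable.of_bound (by fun_prop) (N ^ 2) (Eventually.of_forall fun θ => ?_)
      rw [norm_pow, Real.norm_eq_abs]
      gcongr; exact hvM θ
    have hi3 : Integrable (fun θ => -(c * |s θ|)) uniformAngle := (hi1.const_mul c).neg
    rw [integral_sub hi3 (hi2.div_const 2), integral_neg, integral_const_mul,
      integral_div, integral_abs_mul_cos_add_mul_sin, integral_sq_mul_cos_add_mul_sin]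
    ring
  rw [hlim] at hdct
  refine hdct.congr' ?_
  filter_upwards [eventually_gt_atTop 0] with n hn
  have hn' : (0 : ℝ) < n := by exact_mod_cast hn
  have hi : Integrable (G n) uniformAngle :=
    Integrable.of_bound (hGm n hn).aestronglyMeasurable _ (Eventually.of_forall (hGb n hn))
  have hpt : ∀ θ, Real.exp (-(c / n) * |s θ|) * Real.cos (v θ * w n)
      - S n θ * Real.sin (v θ * w n) = (n : ℝ)⁻¹ * G n θ + 1 := fun θ => by
    simp only [hG]
    rw [show -(c / n) * |s θ| = -(c * |s θ| / n) by ring]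
    field_simp
    ring
  change _ = (n : ℝ) * ((∫ θ, (Real.exp (-(c / n) * |s θ|) * Real.cos (v θ * w n)
      - S n θ * Real.sin (v θ * w n)) ∂uniformAngle) - 1)
  simp_rw [hpt]
  rw [integral_add (hi.const_mul _) (integrable_const _), integral_const_mul]
  simp
  field_simp

/-! ### Characteristic functions and weak convergence in the plane -/

/-- Lévy's convergence theorem in the plane, in coordinates. -/
lemma tendsto_probabilityMeasure_prod_of_tendsto_integral_exp
    {μ : ℕ → ProbabilityMeasure (ℝ × ℝ)} {μ₀ : ProbabilityMeasure (ℝ × ℝ)}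
    (h : ∀ α β : ℝ, Tendsto
      (fun n => ∫ x, Complex.exp ((α * x.1 + β * x.2 : ℝ) * Complex.I) ∂(μ n : Measure (ℝ × ℝ)))
      atTop (𝓝 (∫ x, Complex.exp ((α * x.1 + β * x.2 : ℝ) * Complex.I) ∂(μ₀ : Measure (ℝ × ℝ))))) :
    Tendsto μ atTop (𝓝 μ₀) := by
  -- `ℝ × ℝ` carries the sup norm and no inner product, so laws are transported to `WithLp 2 (ℝ ×
  -- ℝ)`, where `charFun` makes sense, and then back.
  have hto : Continuous (WithLp.toLp 2 : ℝ × ℝ → WithLp 2 (ℝ × ℝ)) := by fun_prop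
  have hof : Continuous (WithLp.ofLp : WithLp 2 (ℝ × ℝ) → ℝ × ℝ) := by fun_prop
  have hmap : ∀ ν : ProbabilityMeasure (ℝ × ℝ),
      (ν.map hto.measurable.aemeasurable).map hof.measurable.aemeasurable = ν := fun ν => by
    apply Subtype.ext
    change Measure.map _ (Measure.map _ (ν : Measure (ℝ × ℝ))) = (ν : Measure (ℝ × ℝ))
    rw [Measure.map_map hof.measurable hto.measurable]
    exact Measure.map_id
  have hchar : ∀ (ν : ProbabilityMeasure (ℝ × ℝ)) (t : WithLp 2 (ℝ × ℝ)),
      charFun (ν.map hto.measurable.aemeasurable : Measure (WithLp 2 (ℝ × ℝ))) t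
        = ∫ x, Complex.exp ((t.fst * x.1 + t.snd * x.2 : ℝ) * Complex.I) ∂(ν : Measure (ℝ × ℝ)) := by
    intro ν t
    rw [charFun_apply, ProbabilityMeasure.toMeasure_map, integral_map hto.measurable.aemeasurable]
    · simp [WithLp.prod_inner_apply]
    · exact Continuous.aestronglyMeasurable (by fun_prop)
  have hlim : Tendsto (fun n => (μ n).map hto.measurable.aemeasurable) atTop
      (𝓝 (μ₀.map hto.measurable.aemeasurable)) := by
    refine ProbabilityMeasure.tendsto_of_tendsto_charFun fun t => ?_
    simp_rw [hchar]
    exact h _ _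
  have := ProbabilityMeasure.tendsto_map_of_tendsto_of_continuous _ _ hlim hof
  simpa only [hmap] using this

lemma integral_exp_centredGaussian (v₁ v₂ : NNReal) (α β : ℝ) :
    ∫ x, Complex.exp ((α * x.1 + β * x.2 : ℝ) * Complex.I) ∂(centredGaussian v₁ v₂)
      = ((Real.exp (-(v₁ * α ^ 2 + v₂ * β ^ 2) / 2) : ℝ) : ℂ) := by
  have h : ∀ x : ℝ × ℝ, Complex.exp ((α * x.1 + β * x.2 : ℝ) * Complex.I)
      = Complex.exp (α * x.1 * Complex.I) * Complex.exp (β * x.2 * Complex.I) := fun x => by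
    rw [← Complex.exp_add]; congr 1; push_cast; ring
  simp_rw [h]
  rw [centredGaussian, integral_prod_mul (fun x : ℝ => Complex.exp (α * x * Complex.I))
    (fun x : ℝ => Complex.exp (β * x * Complex.I)), ← charFun_apply_real, ← charFun_apply_real,
    charFun_gaussianReal, charFun_gaussianReal, ← Complex.exp_add, Complex.ofReal_exp]
  congr 1
  push_cast
  ring

lemma integral_exp_conv (μ ν : Measure (ℝ × ℝ)) [IsFiniteMeasure μ] [IsFiniteMeasure ν]
    (α β : ℝ) :
    ∫ x, Complex.exp ((α * x.1 + β * x.2 : ℝ) * Complex.I) ∂(μ.conv ν)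
      = (∫ x, Complex.exp ((α * x.1 + β * x.2 : ℝ) * Complex.I) ∂μ)
        * ∫ x, Complex.exp ((α * x.1 + β * x.2 : ℝ) * Complex.I) ∂ν := by
  rw [integral_conv]
  · have h : ∀ x y : ℝ × ℝ, Complex.exp ((α * (x + y).1 + β * (x + y).2 : ℝ) * Complex.I)
        = Complex.exp ((α * x.1 + β * x.2 : ℝ) * Complex.I)
          * Complex.exp ((α * y.1 + β * y.2 : ℝ) * Complex.I) := fun x y => by
      rw [← Complex.exp_add]; congr 1; push_cast [Prod.fst_add, Prod.snd_add]; ring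
    simp_rw [h, integral_const_mul, integral_mul_const]
  · exact Integrable.of_bound (Continuous.aestronglyMeasurable (by fun_prop)) 1
      (Eventually.of_forall fun x => (Complex.norm_exp_ofReal_mul_I _).le)

lemma aemeasurable_position {Ω : Type*} [MeasurableSpace Ω] {P : Measure Ω} {n : ℕ}
    {R θ : Fin n → Ω → ℝ} (hR : ∀ j, AEMeasurable (R j) P) (hθ : ∀ j, AEMeasurable (θ j) P)
    (Δ₁ Δ₂ : ℝ) : AEMeasurable (position Δ₁ Δ₂ R θ) P := by
  refine AEMeasurable.prodMk ?_ ?_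
  · exact Finset.aemeasurable_fun_sum _ fun j _ =>
      ((hR j).add_const _).mul (Real.measurable_cos.comp_aemeasurable (hθ j))
  · exact Finset.aemeasurable_fun_sum _ fun j _ =>
      ((hR j).add_const _).mul (Real.measurable_sin.comp_aemeasurable (hθ j))

/-! ### From one step to the sum of independent steps -/

section Steps

variable {Ω : Type*} [MeasurableSpace Ω] {P : Measure Ω} [IsProbabilityMeasure P]

/-- The characteristic function of a single step. -/
lemma integral_exp_step {a : ℝ} (ha : 0 < a) {R θ : Ω → ℝ} (hR : HasLaw R (foldedCauchy a) P)
    (hθ : HasLaw θ uniformAngle P) (hRθ : IndepFun R θ P) (α β Δ₁ Δ₂ : ℝ) :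
    ∫ ω, Complex.exp ((α * ((R ω + Δ₁) * Real.cos (θ ω)) + β * ((R ω + Δ₂) * Real.sin (θ ω)) : ℝ)
        * Complex.I) ∂P
      = ((∫ θ, (Real.exp (-a * |α * Real.cos θ + β * Real.sin θ|)
            * Real.cos ((α * Δ₁) * Real.cos θ + (β * Δ₂) * Real.sin θ)
          - (∫ r, Real.sin ((α * Real.cos θ + β * Real.sin θ) * r) ∂(foldedCauchy a))
            * Real.sin ((α * Δ₁) * Real.cos θ + (β * Δ₂) * Real.sin θ)) ∂uniformAngle : ℝ) : ℂ) := by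
  have := isProbabilityMeasure_foldedCauchy ha
  set f : ℝ × ℝ → ℂ := fun p => Complex.exp (((α * Real.cos p.2 + β * Real.sin p.2) * p.1
        + ((α * Δ₁) * Real.cos p.2 + (β * Δ₂) * Real.sin p.2) : ℝ) * Complex.I) with hf
  have hfc : Continuous f := by fun_prop
  have hlaw : P.map (fun ω => (R ω, θ ω)) = (foldedCauchy a).prod uniformAngle := by
    rw [(indepFun_iff_map_prod_eq_prod_map_map hR.aemeasurable hθ.aemeasurable).1 hRθ,
      hR.map_eq, hθ.map_eq]
  have hfi : Integrable f ((foldedCauchy a).prod uniformAngle) :=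
    Integrable.of_bound hfc.aestronglyMeasurable 1
      (Eventually.of_forall fun x => (Complex.norm_exp_ofReal_mul_I _).le)
  rw [← integral_uniformAngle_integral_exp_foldedCauchy ha]
  calc _ = ∫ ω, f (R ω, θ ω) ∂P := by
        refine integral_congr_ae (Eventually.of_forall fun ω => ?_)
        simp only [hf]
        congr 3; ring
    _ = ∫ p, f p ∂((foldedCauchy a).prod uniformAngle) := by
        rw [← hlaw, integral_map (hR.aemeasurable.prodMk hθ.aemeasurable)
          hfc.aestronglyMeasurable]
    _ = _ := integral_prod_symm _ hfi

/-- The characteristic function of the position is a power of that of a single step. -/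
lemma integral_exp_map_position {n : ℕ} {a : ℝ} (ha : 0 < a) {R θ : Fin n → Ω → ℝ}
    (hR : ∀ j, HasLaw (R j) (foldedCauchy a) P) (hθ : ∀ j, HasLaw (θ j) uniformAngle P)
    (hRθ : ∀ j, IndepFun (R j) (θ j) P) (hsteps : iIndepFun (fun j ω => (R j ω, θ j ω)) P)
    (α β Δ₁ Δ₂ : ℝ) :
    ∫ x, Complex.exp ((α * x.1 + β * x.2 : ℝ) * Complex.I) ∂(P.map (position Δ₁ Δ₂ R θ))
      = (((∫ θ, (Real.exp (-a * |α * Real.cos θ + β * Real.sin θ|)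
            * Real.cos ((α * Δ₁) * Real.cos θ + (β * Δ₂) * Real.sin θ)
          - (∫ r, Real.sin ((α * Real.cos θ + β * Real.sin θ) * r) ∂(foldedCauchy a))
            * Real.sin ((α * Δ₁) * Real.cos θ + (β * Δ₂) * Real.sin θ)) ∂uniformAngle) ^ n : ℝ)
          : ℂ) := by
  set g : ℝ × ℝ → ℝ := fun p =>
    α * ((p.1 + Δ₁) * Real.cos p.2) + β * ((p.1 + Δ₂) * Real.sin p.2) with hg
  have hgm : Measurable g := by fun_prop
  have hpair : ∀ j, AEMeasurable (fun ω => (R j ω, θ j ω)) P := fun j =>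
    (hR j).aemeasurable.prodMk (hθ j).aemeasurable
  have hind : iIndepFun (fun j ω => g (R j ω, θ j ω)) P := hsteps.comp (fun _ => g) fun _ => hgm
  have hgR : ∀ j, AEMeasurable (fun ω => g (R j ω, θ j ω)) P := fun j =>
    hgm.comp_aemeasurable (hpair j)
  have hexp : ∀ x : ℝ, Complex.exp ((1 : ℝ) * x * Complex.I) = Complex.exp (x * Complex.I) :=
    fun x => by simp
  -- The frequencies `α, β` are already built into the scalar projection `g`, so one-dimensional
  -- characteristic functions at `1` suffice.
  have hprod := congrFun (iIndepFun.charFun_map_fun_sum_eq_prod hgR hind) 1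
  rw [Finset.prod_apply, charFun_apply_real,
    integral_map (Finset.aemeasurable_fun_sum _ fun j _ => hgR j)
      (Continuous.aestronglyMeasurable (by fun_prop))] at hprod
  simp_rw [hexp] at hprod
  rw [integral_map (aemeasurable_position (fun j => (hR j).aemeasurable)
    (fun j => (hθ j).aemeasurable) _ _) (Continuous.aestronglyMeasurable (by fun_prop))]
  have hpos : ∀ ω, α * (position Δ₁ Δ₂ R θ ω).1 + β * (position Δ₁ Δ₂ R θ ω).2
      = ∑ j, g (R j ω, θ j ω) := fun ω => by
    simp only [position, hg, Finset.mul_sum, Finset.sum_add_distrib]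
  simp_rw [hpos]
  rw [hprod, Complex.ofReal_pow]
  have hchar : ∀ j, charFun (P.map fun ω => g (R j ω, θ j ω)) 1
      = ∫ ω, Complex.exp (g (R j ω, θ j ω) * Complex.I) ∂P := fun j => by
    rw [charFun_apply_real, integral_map (hgR j) (Continuous.aestronglyMeasurable (by fun_prop))]
    simp_rw [hexp]
  have hstep := fun j => (hchar j).trans
    (integral_exp_step ha (hR j) (hθ j) (hRθ j) α β Δ₁ Δ₂)
  rw [Finset.prod_congr rfl fun j _ => hstep j]
  simp

end Steps

/-- Joint independence is expressed as independence of the pairs together with independence inside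
each pair. The existential supplies the instance that makes the convolution a probability measure,
as `TendstoInDistribution` needs. -/
theorem theorem2 {Ω : ℕ → Type*} [∀ n, MeasurableSpace (Ω n)]
    (P : ∀ n, Measure (Ω n)) [∀ n, IsProbabilityMeasure (P n)]
    (C₁ C₂ b : ℝ) (hC₁ : 0 < C₁) (hC₂ : 0 < C₂) (hb : 0 < b)
    (R θ : ∀ n, Fin n → Ω n → ℝ)
    (hR : ∀ n j, HasLaw (R n j) (foldedCauchy (Real.pi * b / (2 * (n : ℝ)))) (P n))
    (hθ : ∀ n j, HasLaw (θ n j) uniformAngle (P n))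
    (hRθ : ∀ n j, IndepFun (R n j) (θ n j) (P n))
    (hsteps : ∀ n, iIndepFun (fun j ω => (R n j ω, θ n j ω)) (P n)) :
    ∃ _ : IsProbabilityMeasure (circularCauchy b),
      TendstoInDistribution
        (fun n : ℕ => position (C₁ * (n : ℝ) ^ (-(1 / 2) : ℝ)) (C₂ * (n : ℝ) ^ (-(1 / 2) : ℝ))
          (R n) (θ n))
        atTop (id : ℝ × ℝ → ℝ × ℝ) P
        ((centredGaussian (C₁ ^ 2 / 2).toNNReal (C₂ ^ 2 / 2).toNNReal).conv (circularCauchy b)) ∧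
      ∀ α β : ℝ,
        ∫ x, Complex.exp (Complex.I * ((α * x.1 + β * x.2 : ℝ) : ℂ)) ∂(circularCauchy b) =
          ((Real.exp (-b * Real.sqrt (α ^ 2 + β ^ 2)) : ℝ) : ℂ) := by
  have hprob := isProbabilityMeasure_circularCauchy hb
  have hpi := Real.pi_pos
  refine ⟨hprob, ⟨fun n => aemeasurable_position (fun j => (hR n j).aemeasurable)
    (fun j => (hθ n j).aemeasurable) _ _, aemeasurable_id, ?_⟩, fun α β => ?_⟩
  · refine tendsto_probabilityMeasure_prod_of_tendsto_integral_exp fun α β => ?_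
    simp only [ProbabilityMeasure.coe_mk, Measure.map_id]
    rw [integral_exp_conv, integral_exp_centredGaussian, integral_exp_circularCauchy hb,
      ← Complex.ofReal_mul, ← Real.exp_add, Real.coe_toNNReal _ (by positivity),
      Real.coe_toNNReal _ (by positivity)]
    -- If `n xₙ → t` then `(1 + xₙ)^n → exp t`, here with `xₙ` the step's characteristic function
    -- minus one and `c = π b / 2`, so that the scale is `c / n`.
    have hlim := Real.tendsto_one_add_pow_exp_of_tendsto (tendsto_mul_step_sub_one
      (c := Real.pi * b / 2) (by positivity) α β (α * C₁) (β * C₂))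
    have hval : -(Real.pi * b / 2 * (Real.sqrt (α ^ 2 + β ^ 2) * (2 / Real.pi)))
        - ((α * C₁) ^ 2 + (β * C₂) ^ 2) / 4
        = -(C₁ ^ 2 / 2 * α ^ 2 + C₂ ^ 2 / 2 * β ^ 2) / 2 + -b * Real.sqrt (α ^ 2 + β ^ 2) := by
      field_simp; ring
    rw [hval] at hlim
    refine ((Complex.continuous_ofReal.tendsto _).comp hlim).congr' ?_
    -- At `n = 0` the scale is a division by zero, so that index is discarded.
    filter_upwards [eventually_gt_atTop 0] with n hn
    have hn' : (0 : ℝ) < n := by exact_mod_cast hn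
    rw [integral_exp_map_position (by positivity) (hR n) (hθ n) (hRθ n) (hsteps n)]
    simp only [Function.comp_apply, add_sub_cancel, div_div, mul_assoc]
  · rw [← integral_exp_circularCauchy hb]
    simp_rw [mul_comm Complex.I]
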